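/- Let $l^2$ be the complex Hilbert space of square summable complex sequences, let $B^\infty(r)=\{w\in l^2:\|w\|<r\}$ and $B^\infty=B^\infty(1)$. For $q\ge 1$ let $\Delta^q(r)=\{z\in\mathbb C^q: |z_i|<r \text{ for all } i\}$, $\Delta^q=\Delta^q(1)$, $\Delta(r)=\Delta^1(r)$, $\Delta=\Delta(1)$, and $A^q_{r_1,r_2}=\Delta^q(r_2)\setminus\overline{\Delta^q(r_1)}$ for $0<r_1<r_2$. For $D\subset\mathbb C^q$ and $\mathcal B\subset l^2$, the product $D\times\mathcal B$ denotes the set of all sequences $(z_1,\dots,z_q,w_1,w_2,\dots)\in l^2$ with $(z_1,\dots,z_q)\in D$ and $(w_1,w_2,\dots)\in\mathcal B$. For $0<r<1$ put $$H_q^1(r)=(\Delta^q\times\Delta(r))\cup(A^q_{1-r,1}\times\Delta)\subset\mathbb C^{q+1},$$ $$H_q^\infty(r)=(\Delta^q\times B^\infty(r))\cup(A^q_{1-r,1}\times B^\infty)\subset l^2.$$ A complex Hilbert manifold here is a Hausdorff, second countable complex manifold modeled on $l^2$. Such a manifold $\mathcal X$ is called $q$-Hartogs if for every $0<r<1$ every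 holomorphic map $H_q^1(r)\to\mathcal X$ extends to a holomorphic map $\Delta^{q+1}\to\mathcal X$. **Theorem.** Let $q\ge 1$ and let $\mathcal X$ be a $q$-Hartogs complex Hilbert manifold. Then for every $0<r<1$, every holomorphic map $f:H_q^\infty(r)\to\mathcal X$ extends to a holomorphic map $\tilde f:\Delta^q\times B^\infty\to\mathcal X$. -/

import Mathlib

open scoped Manifold ContDiff lp

/-- The Hilbert space `l²` of square summable sequences of complex numbers. -/
abbrev SeqHilbert : Type := ℓ²(ℕ, ℂ)

/-- The sequence `(x_q, x_{q+1}, …)`: the `w`-coordinates of `x = (z_1, …, z_q, w_1, w_2, …)`. -/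
def seqTail (q : ℕ) (x : SeqHilbert) : SeqHilbert :=
  ⟨fun k => x (k + q), by
    have hx : Summable fun k => ‖x k‖ ^ (2 : ENNReal).toReal :=
      (lp.memℓp x).summable (by norm_num)
    exact memℓp_gen (hx.comp_injective (add_left_injective q))⟩

/-- The vector `(x_0, …, x_{q-1})`: the `z`-coordinates of `x = (z_1, …, z_q, w_1, w_2, …)`. -/
def seqHead (q : ℕ) (x : SeqHilbert) : Fin q → ℂ := fun i => x (i : ℕ)

/-- The polydisk `Δ^q(r)` in `ℂ^q`, centered at the origin. -/
def polydisk (q : ℕ) (r : ℝ) : Set (Fin q → ℂ) := {z | ∀ i, ‖z i‖ < r}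

/-- The ring domain `A^q_{r₁,r₂}`. -/
def ringDomain (q : ℕ) (r₁ r₂ : ℝ) : Set (Fin q → ℂ) :=
  polydisk q r₂ \ closure (polydisk q r₁)

/-- The product `D × E` as a subset of `ℂ^{q+1}`. -/
def finProd {q : ℕ} (D : Set (Fin q → ℂ)) (E : Set ℂ) : Set (Fin (q + 1) → ℂ) :=
  {x | Fin.init x ∈ D ∧ x (Fin.last q) ∈ E}

/-- The product `D × B` as a subset of `l²`. -/
def seqProd {q : ℕ} (D : Set (Fin q → ℂ)) (B : Set SeqHilbert) : Set SeqHilbert :=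
  {x | seqHead q x ∈ D ∧ seqTail q x ∈ B}

/-- The `q`-concave Hartogs figure `H_q^1(r)` in `ℂ^{q+1}`. -/
def hartogsFigure (q : ℕ) (r : ℝ) : Set (Fin (q + 1) → ℂ) :=
  finProd (polydisk q 1) (Metric.ball 0 r) ∪ finProd (ringDomain q (1 - r) 1) (Metric.ball 0 1)

/-- The `q`-concave Hartogs figure `H_q^∞(r)` in `l²`. -/
def hartogsFigureInf (q : ℕ) (r : ℝ) : Set SeqHilbert :=
  seqProd (polydisk q 1) (Metric.ball 0 r) ∪ seqProd (ringDomain q (1 - r) 1) (Metric.ball 0 1)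

/-- `X` is `q`-Hartogs: for every `0 < r < 1`, every holomorphic map `H_q^1(r) → X` extends to a
holomorphic map `Δ^{q+1} → X`. Maps on an open set are represented by total functions whose values
elsewhere are irrelevant. -/
def IsHartogs (q : ℕ) (X : Type*) [TopologicalSpace X] [ChartedSpace SeqHilbert X] : Prop :=
  ∀ r : ℝ, 0 < r → r < 1 → ∀ f : (Fin (q + 1) → ℂ) → X,
    MDifferentiableOn 𝓘(ℂ, Fin (q + 1) → ℂ) 𝓘(ℂ, SeqHilbert) f (hartogsFigure q r) →
    ∃ g : (Fin (q + 1) → ℂ) → X,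
      MDifferentiableOn 𝓘(ℂ, Fin (q + 1) → ℂ) 𝓘(ℂ, SeqHilbert) g (polydisk (q + 1) 1) ∧
      Set.EqOn g f (hartogsFigure q r)

/-!
A holomorphic map `Δ^q → X` to a Hausdorff manifold is determined by its restriction to the ring
domain (`Convex.eqOn_of_mdifferentiableOn`). The Hartogs property, applied to the restriction of `f`
to `Δ^q` times a disc in a complex line of `l²` (`IsHartogs.exists_extension_line`), therefore
defines the extension `g (z, w)` slice by slice for each `w` in the unit ball, and shows that `g` is
holomorphic on `Δ^q` times a disc containing `w` in the complex line through `w` and any point near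
`0`. It remains to show that `g` is holomorphic jointly in `(z, w)`
(`mdifferentiableOn_prod_of_lines`).

This holds over the ring domain, where `g = f`, and it propagates from there. Suppose `G (ζ, κ)` is
jointly holomorphic for `ζ` near a point `o` and holomorphic in `ζ` on a larger ball. In a chart, the
homogeneous components at `o` of `G (·, κ)` depend holomorphically on `κ`. If `G (·, κ)` maps the
larger ball into one chart ball for all `κ` in a set `M`, Cauchy's estimates hold for these
components when `κ ∈ M`; if moreover `M` satisfies the maximum principle for an open set `N`, they
hold for all `κ ∈ N`, so the expansion converges on the larger ball and `G` is jointly holomorphic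
there for `κ ∈ N` (`mdifferentiableAt_of_norming`).

Propagation is used twice for each `w₁` in the unit ball. Parametrize the complex lines through `w₁`
by their intersection `κ` with a neighbourhood of `0`, and put
`G ((z, l), κ) = g (z, l w₁ + (1 - l) κ)`. By Baire's theorem there is a `κ` such that, whenever
`G (·, κ)` maps a ball into a chart ball, the same is true for a set `M` of parameters that is dense
near `κ`; then `G` is jointly holomorphic near all points `(ζ, κ)`
(`exists_forall_eventually_mdifferentiableAt`). This controls `g` on a cone with vertex `w₁`. In the
second use `M` is this cone, and it satisfies the maximum principle for a neighbourhood of `w₁`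
because the boundaries of small discs parallel to the axis of the cone lie in it.
-/

open Set Filter Topology Metric

/-! ### Holomorphic maps between complex normed spaces -/

/-- The difference of two functions of the sequence is bounded by `ε` on a ball of radius `r`, so by
the Schwarz lemma its derivative at the centre is at most `2ε / r`. Hence the derivatives form a
uniform Cauchy sequence near each point. -/
theorem TendstoUniformlyOn.differentiableOn_complex {E H : Type*} [NormedAddCommGroup E]
    [NormedSpace ℂ E] [NormedAddCommGroup H] [NormedSpace ℂ H] [CompleteSpace H]
    {F : ℕ → E → H} {f : E → H} {U : Set E} (hU : IsOpen U)
    (hF : ∀ n, DifferentiableOn ℂ (F n) U) (hlim : TendstoUniformlyOn F f atTop U) :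
    DifferentiableOn ℂ f U := by
  intro x hx
  obtain ⟨r, hr, hrU⟩ : ∃ r > 0, ball x (2 * r) ⊆ U := by
    obtain ⟨r, hr, h⟩ := Metric.isOpen_iff.1 hU x hx
    exact ⟨r / 2, by positivity, by rwa [mul_div_cancel₀ _ two_ne_zero]⟩
  have hsub : ∀ y ∈ ball x r, ball y r ⊆ U := fun y hy =>
    (ball_subset_ball' (by rw [mem_ball] at hy; linarith)).trans hrU
  have hcauchy : UniformCauchySeqOn (fun n => fderiv ℂ (F n)) atTop (ball x r) := by
    rw [Metric.uniformCauchySeqOn_iff]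
    intro ε hε
    have hc := hlim.uniformCauchySeqOn
    rw [Metric.uniformCauchySeqOn_iff] at hc
    obtain ⟨N, hN⟩ := hc (ε * r / 4) (by positivity)
    refine ⟨N, fun m hm n hn y hy => ?_⟩
    have hyU : y ∈ U := hsub y hy (mem_ball_self hr)
    have hd : ∀ k, DifferentiableAt ℂ (F k) y := fun k => (hF k).differentiableAt (hU.mem_nhds hyU)
    have key : ‖fderiv ℂ (fun z => F m z - F n z) y‖ ≤ ε * r / 2 / r := by
      refine Complex.norm_fderiv_le_div_of_mapsTo_ball
        (((hF m).sub (hF n)).mono (hsub y hy)) (fun z hz => ?_) hr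
      have h1 := hN m hm n hn z (hsub y hy hz)
      have h2 := hN m hm n hn y hyU
      rw [dist_eq_norm] at h1 h2
      rw [mem_closedBall, dist_eq_norm]
      exact (norm_sub_le _ _).trans (by linarith)
    rw [fderiv_fun_sub (hd m) (hd n)] at key
    rw [dist_eq_norm]
    refine key.trans_lt ?_
    rw [div_lt_iff₀ hr]
    nlinarith [mul_pos hε hr]
  have hpt : ∀ y ∈ ball x r, ∃ g, Tendsto (fun n => fderiv ℂ (F n) y) atTop (𝓝 g) :=
    fun y hy => cauchySeq_tendsto_of_complete (hcauchy.cauchySeq hy)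
  choose! g hg using hpt
  have hder := hasFDerivAt_of_tendstoUniformlyOn isOpen_ball
    (hcauchy.tendstoUniformlyOn_of_tendsto hg)
    (fun n y hy => ((hF n).differentiableAt
      (hU.mem_nhds (hsub y hy (mem_ball_self hr)))).hasFDerivAt)
    (fun y hy => hlim.tendsto_at (hsub y hy (mem_ball_self hr))) (mem_ball_self hr)
  exact hder.differentiableAt.differentiableWithinAt

/-- The partial derivative of a holomorphic function of `(t, x)` in the scalar variable `t` is
holomorphic in `(t, x)`: it is a locally uniform limit of difference quotients, by the second order
form of the Schwarz lemma. -/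
theorem differentiableOn_deriv_left {E H : Type*} [NormedAddCommGroup E]
    [NormedSpace ℂ E] [NormedAddCommGroup H] [NormedSpace ℂ H] [CompleteSpace H]
    {F : ℂ × E → H} {U : Set (ℂ × E)} (hU : IsOpen U) (hF : DifferentiableOn ℂ F U) :
    DifferentiableOn ℂ (fun p : ℂ × E => deriv (fun s => F (s, p.2)) p.1) U := by
  intro p hp
  obtain ⟨r, hr, hrU, C, hC⟩ : ∃ r > 0, ball p (2 * r) ⊆ U ∧ ∃ C, ∀ y ∈ ball p (2 * r),
      ‖F y‖ ≤ C := by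
    have hcont : ContinuousAt F p := hF.continuousOn.continuousAt (hU.mem_nhds hp)
    have hb : ∀ᶠ y in 𝓝 p, ‖F y‖ < ‖F p‖ + 1 :=
      hcont.norm.eventually (gt_mem_nhds (lt_add_one _))
    obtain ⟨r, hr, h⟩ := Metric.eventually_nhds_iff_ball.1 (hb.and (hU.mem_nhds hp))
    refine ⟨r / 2, by positivity, ?_, ‖F p‖ + 1, ?_⟩ <;>
    rw [mul_div_cancel₀ _ two_ne_zero]
    exacts [fun y hy => (h y hy).2, fun y hy => (h y hy).1.le]
  have hC0 : 0 ≤ C := (norm_nonneg _).trans (hC p (mem_ball_self (by positivity)))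
  have hmem : ∀ y ∈ ball p r, ∀ s ∈ ball (0 : ℂ) r, (y.1 + s, y.2) ∈ ball p (2 * r) := by
    intro y hy s hs
    rw [mem_ball, Prod.dist_eq, max_lt_iff] at hy ⊢
    rw [mem_ball_zero_iff] at hs
    have : dist (y.1 + s) p.1 ≤ ‖s‖ + dist y.1 p.1 := by
      rw [dist_eq_norm, dist_eq_norm, add_sub_right_comm, add_comm (y.1 - p.1)]
      exact norm_add_le _ _
    exact ⟨by linarith, by linarith⟩
  have hline : ∀ y ∈ ball p r, DifferentiableOn ℂ (fun s : ℂ => F (y.1 + s, y.2)) (ball 0 r) := by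
    intro y hy
    refine hF.comp (by fun_prop) fun s hs => hrU (hmem y hy s hs)
  have hquad : ∀ y ∈ ball p r, ∀ s ∈ ball (0 : ℂ) r,
      ‖F (y.1 + s, y.2) - F y - s • deriv (fun s => F (s, y.2)) y.1‖ ≤
        4 * C * (‖s‖ / r) ^ 2 := by
    intro y hy s hs
    set D := deriv (fun s => F (s, y.2)) y.1 with hD
    have h0 : HasDerivAt (fun s : ℂ => F (y.1 + s, y.2)) D 0 := by
      have h1 := ((hline y hy).differentiableAt (ball_mem_nhds _ hr)).hasDerivAt
      have h2 := deriv_comp_const_add (fun s => F (s, y.2)) y.1 0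
      rw [add_zero] at h2
      rwa [h2] at h1
    have hmaps : MapsTo (fun s : ℂ => F (y.1 + s, y.2)) (ball 0 r)
        (closedBall (F (y.1 + 0, y.2)) (2 * C)) := by
      intro s hs
      rw [mem_closedBall, dist_eq_norm]
      have h1 := hC _ (hmem y hy s hs)
      have h2 := hC _ (hmem y hy 0 (mem_ball_self hr))
      exact (norm_sub_le _ _).trans (by linarith)
    have hDle : ‖D‖ ≤ 2 * C / r := by
      rw [← h0.deriv]
      exact Complex.norm_deriv_le_div_of_mapsTo_ball (hline y hy) hmaps hr
    have hlin : ∀ s ∈ ball (0 : ℂ) r, ‖s • D‖ ≤ 2 * C := by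
      intro s hs
      rw [mem_ball_zero_iff] at hs
      rw [norm_smul]
      calc ‖s‖ * ‖D‖ ≤ r * (2 * C / r) := by gcongr
        _ = 2 * C := by field_simp
    have := Complex.dist_le_mul_div_pow_of_mapsTo_ball_of_isLittleO (n := 1) (R₂ := 4 * C)
      (f := fun s : ℂ => F (y.1 + s, y.2) - s • D) (c := 0) (R₁ := r)
      ((hline y hy).sub (by fun_prop)) (fun s hs => ?_) ?_ hs
    · simpa [dist_eq_norm, sub_right_comm] using this
    · have h1 := hmaps hs
      rw [mem_closedBall, dist_eq_norm] at h1 ⊢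
      rw [zero_smul, sub_zero, sub_right_comm]
      exact (norm_sub_le _ _).trans (by linarith [hlin s hs])
    · have h1 := h0.isLittleO
      simp only [sub_zero, pow_one, zero_smul] at h1 ⊢
      refine (h1.congr_left fun s => ?_).norm_right
      rw [sub_right_comm]
  -- the difference quotients with step `r / (n + 2)` stay inside the ball of radius `2 * r`
  have hstep : ∀ n : ℕ, ((r / (n + 2) : ℝ) : ℂ) ∈ ball (0 : ℂ) r := by
    intro n
    rw [mem_ball_zero_iff, Complex.norm_real, Real.norm_of_nonneg (by positivity)]
    exact div_lt_self hr (by linarith [n.cast_nonneg (α := ℝ)])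
  have hlim : TendstoUniformlyOn
      (fun (n : ℕ) (y : ℂ × E) =>
        (((r / (n + 2) : ℝ) : ℂ))⁻¹ • (F (y.1 + ((r / (n + 2) : ℝ) : ℂ), y.2) - F y))
      (fun y => deriv (fun s => F (s, y.2)) y.1) atTop (ball p r) := by
    rw [Metric.tendstoUniformlyOn_iff]
    intro ε hε
    have ht : Tendsto (fun n : ℕ => 4 * C / r * (1 / ((n : ℝ) + 2))) atTop (𝓝 0) := by
      have h1 : Tendsto (fun n : ℕ => (1 / ((n : ℝ) + 2))) atTop (𝓝 0) := by
        simp only [one_div]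
        exact tendsto_inv_atTop_zero.comp
          (tendsto_atTop_add_const_right _ _ tendsto_natCast_atTop_atTop)
      simpa using h1.const_mul (4 * C / r)
    filter_upwards [ht.eventually (gt_mem_nhds hε)] with n hn y hy
    refine lt_of_le_of_lt ?_ hn
    set s : ℂ := ((r / (n + 2) : ℝ) : ℂ) with hs
    have hsn : ‖s‖ = r / (n + 2) := by
      rw [hs, Complex.norm_real, Real.norm_of_nonneg (by positivity)]
    have hs0 : s ≠ 0 := by rw [← norm_pos_iff, hsn]; positivity
    have h := hquad y hy s (hstep n)
    rw [dist_comm, dist_eq_norm]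
    have heq : s⁻¹ • (F (y.1 + s, y.2) - F y) - deriv (fun s => F (s, y.2)) y.1 =
        s⁻¹ • (F (y.1 + s, y.2) - F y - s • deriv (fun s => F (s, y.2)) y.1) := by
      rw [smul_sub s⁻¹ (_ - _), smul_smul, inv_mul_cancel₀ hs0, one_smul]
    rw [heq, norm_smul, norm_inv, hsn]
    rw [hsn] at h
    calc (r / ((n : ℝ) + 2))⁻¹ * _ ≤ (r / ((n : ℝ) + 2))⁻¹ *
          (4 * C * (r / ((n : ℝ) + 2) / r) ^ 2) := by gcongr
      _ = _ := by field_simp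
  have hd := TendstoUniformlyOn.differentiableOn_complex isOpen_ball (fun n => ?_) hlim
  · exact (hd.differentiableAt (ball_mem_nhds _ hr)).differentiableWithinAt
  · have h1 : DifferentiableOn ℂ F (ball p r) :=
      hF.mono ((ball_subset_ball (by linarith)).trans hrU)
    have h2 : DifferentiableOn ℂ (fun y : ℂ × E => F (y.1 + ((r / (n + 2) : ℝ) : ℂ), y.2))
        (ball p r) :=
      hF.comp (by fun_prop) fun y hy => hrU (hmem y hy _ (hstep n))
    exact (h2.sub h1).const_smul _

theorem differentiableOn_iteratedDeriv_left {E H : Type*} [NormedAddCommGroup E]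
    [NormedSpace ℂ E] [NormedAddCommGroup H] [NormedSpace ℂ H] [CompleteSpace H]
    {F : ℂ × E → H} {U : Set (ℂ × E)} (hU : IsOpen U) (hF : DifferentiableOn ℂ F U) (n : ℕ) :
    DifferentiableOn ℂ (fun p : ℂ × E => iteratedDeriv n (fun s => F (s, p.2)) p.1) U := by
  induction n with
  | zero => simpa using hF
  | succ n ih =>
    simp only [iteratedDeriv_succ]
    exact differentiableOn_deriv_left hU ih

/-! ### Holomorphic maps into a complex manifold -/

/-- Two holomorphic maps from a convex open set to a Hausdorff manifold that agree near one point
agree everywhere: along the complex line through two points the set where they agree locally is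
open and closed. -/
theorem Convex.eqOn_of_mdifferentiableOn {E H X : Type*} [NormedAddCommGroup E] [NormedSpace ℂ E]
    [NormedAddCommGroup H] [NormedSpace ℂ H] [CompleteSpace H] [TopologicalSpace X] [T2Space X]
    [ChartedSpace H X] [IsManifold 𝓘(ℂ, H) 1 X] {D : Set E} (hD : IsOpen D) (hconv : Convex ℝ D)
    {F G : E → X} (hF : MDifferentiableOn 𝓘(ℂ, E) 𝓘(ℂ, H) F D)
    (hG : MDifferentiableOn 𝓘(ℂ, E) 𝓘(ℂ, H) G D) {o : E} (ho : o ∈ D) (hFG : F =ᶠ[𝓝 o] G) :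
    EqOn F G D := by
  intro x hx
  let ℓ : ℂ → E := fun t => o + t • (x - o)
  have hℓ : Differentiable ℂ ℓ := by fun_prop
  set S : Set ℂ := ℓ ⁻¹' D with hS
  have hSo : IsOpen S := hD.preimage hℓ.continuous
  have hSconv : Convex ℝ S := by
    intro a ha b hb s t hs ht hst
    have : ℓ (s • a + t • b) = s • ℓ a + t • ℓ b := by
      have hs' : s = 1 - t := by linarith
      subst hs'
      simp only [ℓ, ← Complex.coe_smul (1 - t), ← Complex.coe_smul t]
      push_cast
      module
    rw [hS, mem_preimage, this]
    exact hconv ha hb hs ht hst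
  have hf : MDifferentiableOn 𝓘(ℂ, ℂ) 𝓘(ℂ, H) (F ∘ ℓ) S :=
    hF.comp hℓ.mdifferentiable.mdifferentiableOn subset_rfl
  have hg : MDifferentiableOn 𝓘(ℂ, ℂ) 𝓘(ℂ, H) (G ∘ ℓ) S :=
    hG.comp hℓ.mdifferentiable.mdifferentiableOn subset_rfl
  let T : Set ℂ := {t | F ∘ ℓ =ᶠ[𝓝 t] G ∘ ℓ}
  have hsub : S ⊆ T := by
    refine hSconv.isPreconnected.subset_of_closure_inter_subset isOpen_setOfPred_eventually_nhds ?_ ?_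
    · refine ⟨0, by simpa [hS, ℓ] using ho, ?_⟩
      have h0 : Tendsto ℓ (𝓝 0) (𝓝 o) := by
        simpa [ℓ] using hℓ.continuous.tendsto 0
      exact h0.eventually hFG
    · rintro t ⟨htT, htS⟩
      have hfc := (hf.mdifferentiableAt (hSo.mem_nhds htS)).continuousAt
      have hgc := (hg.mdifferentiableAt (hSo.mem_nhds htS)).continuousAt
      have hfreq : ∃ᶠ s in 𝓝 t, (F ∘ ℓ) s = (G ∘ ℓ) s :=
        (mem_closure_iff_frequently.1 htT).mono fun s hs => hs.self_of_nhds
      have heq : (F ∘ ℓ) t = (G ∘ ℓ) t := by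
        by_contra hne
        obtain ⟨u, v, hu, hv, hxu, hxv, huv⟩ := t2_separation hne
        have h1 := hfc.eventually (hu.mem_nhds hxu)
        have h2 := hgc.eventually (hv.mem_nhds hxv)
        obtain ⟨s, hs, hs1, hs2⟩ := (hfreq.and_eventually (h1.and h2)).exists
        exact huv.le_bot ⟨hs1, hs ▸ hs2⟩
      let e := chartAt H ((F ∘ ℓ) t)
      have h1 : ∀ᶠ s in 𝓝 t, (F ∘ ℓ) s ∈ e.source :=
        hfc.eventually (e.open_source.mem_nhds (mem_chart_source H _))
      have h2 : ∀ᶠ s in 𝓝 t, (G ∘ ℓ) s ∈ e.source :=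
        hgc.eventually (e.open_source.mem_nhds (heq ▸ mem_chart_source H _))
      obtain ⟨ε, hε, hball⟩ :=
        Metric.eventually_nhds_iff_ball.1 ((h1.and h2).and (hSo.mem_nhds htS))
      have hdiff : ∀ u : ℂ → X, MDifferentiableOn 𝓘(ℂ, ℂ) 𝓘(ℂ, H) u S →
          (∀ s ∈ ball t ε, u s ∈ e.source) → AnalyticOnNhd ℂ (e ∘ u) (ball t ε) := by
        intro u hu hue
        refine DifferentiableOn.analyticOnNhd (fun s hs => ?_) isOpen_ball
        have h3 := (mdifferentiableAt_atlas (I := 𝓘(ℂ, H)) (chart_mem_atlas H _) (hue s hs)).comp s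
          (hu.mdifferentiableAt (hSo.mem_nhds (hball s hs).2))
        exact (mdifferentiableAt_iff_differentiableAt.1 h3).differentiableWithinAt
      obtain ⟨s, hsT, hsb⟩ := (mem_closure_iff_frequently.1 htT).and_eventually
        (ball_mem_nhds t hε) |>.exists
      have hEq := (hdiff _ hf fun s hs => (hball s hs).1.1).eqOn_of_preconnected_of_eventuallyEq
        (hdiff _ hg fun s hs => (hball s hs).1.2) (convex_ball t ε).isPreconnected hsb
        (hsT.mono fun y hy => congrArg e hy)
      refine Metric.eventually_nhds_iff_ball.2 ⟨ε, hε, fun y hy => ?_⟩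
      exact e.injOn (hball y hy).1.1 (hball y hy).1.2 (hEq hy)
  have h1 : (1 : ℂ) ∈ T := hsub (by simpa [hS, ℓ] using hx)
  simpa [ℓ] using h1.self_of_nhds

/-! ### Propagation of joint holomorphy -/

/-- Vector-valued propagation. A function `u` holomorphic near the centre in `ζ` and for `κ ∈ N` is
given there by its homogeneous expansion in `ζ`, whose terms are holomorphic in `κ ∈ N`. If for `κ`
in a set `M` satisfying the maximum principle for `N` the function `u (·, κ)` is bounded by `ρ` on a
large ball, Cauchy's estimates hold for `κ ∈ M`, hence for all `κ ∈ N`, and the expansion converges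
on the large ball. -/
theorem exists_differentiableOn_ball_prod_of_norming {E₁ E₂ H : Type*} [NormedAddCommGroup E₁]
    [NormedSpace ℂ E₁] [NormedAddCommGroup E₂] [NormedSpace ℂ E₂] [NormedAddCommGroup H]
    [NormedSpace ℂ H] [CompleteSpace H] {u : E₁ × E₂ → H} {s d ρ : ℝ} (hs : 0 < s) (hsd : s ≤ d)
    {N M : Set E₂} (hN : IsOpen N) (hu : DifferentiableOn ℂ u (ball 0 s ×ˢ N))
    (huM : ∀ κ ∈ M, DifferentiableOn ℂ (fun ζ => u (ζ, κ)) (ball 0 d))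
    (hbound : ∀ κ ∈ M, ∀ ζ ∈ ball (0 : E₁) d, ‖u (ζ, κ)‖ ≤ ρ)
    (hmax : ∀ v : E₂ → H, DifferentiableOn ℂ v N → ∀ C : ℝ, (∀ κ ∈ M, ‖v κ‖ ≤ C) →
      ∀ κ ∈ N, ‖v κ‖ ≤ C) :
    ∃ F : E₁ × E₂ → H, DifferentiableOn ℂ F (ball 0 d ×ˢ N) ∧
      (∀ p ∈ ball (0 : E₁) d ×ˢ N, ‖F p‖ ≤ ρ) ∧ EqOn F u (ball 0 s ×ˢ N) := by
  have hd : 0 < d := hs.trans_le hsd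
  let Φ : ℂ × (E₁ × E₂) → H := fun q => u (q.1 • q.2.1, q.2.2)
  let Ω : Set (ℂ × (E₁ × E₂)) := {q | q.1 • q.2.1 ∈ ball (0 : E₁) s ∧ q.2.2 ∈ N}
  have hΩ : IsOpen Ω :=
    (isOpen_ball.preimage (f := fun q : ℂ × (E₁ × E₂) => q.1 • q.2.1) (by fun_prop)).inter
      (hN.preimage (f := fun q : ℂ × (E₁ × E₂) => q.2.2) (by fun_prop))
  have hΦ : DifferentiableOn ℂ Φ Ω :=
    hu.comp (f := fun q : ℂ × (E₁ × E₂) => (q.1 • q.2.1, q.2.2)) (by fun_prop)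
      fun q hq => ⟨hq.1, hq.2⟩
  -- the homogeneous component of degree `n`
  let a : ℕ → E₁ × E₂ → H := fun n p =>
    (n.factorial : ℂ)⁻¹ • iteratedDeriv n (fun t => Φ (t, p)) 0
  have ha : ∀ n, DifferentiableOn ℂ (a n) (univ ×ˢ N) := by
    intro n
    have h1 := differentiableOn_iteratedDeriv_left hΩ hΦ n
    have h2 := h1.comp (f := fun p : E₁ × E₂ => ((0 : ℂ), p)) (s := univ ×ˢ N) (by fun_prop)
      (fun p hp => ⟨by simpa using hs, hp.2⟩)
    exact h2.const_smul _
  have haN : ∀ n ζ, DifferentiableOn ℂ (fun κ => a n (ζ, κ)) N := fun n ζ =>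
    (ha n).comp (f := fun κ : E₂ => (ζ, κ)) (by fun_prop) fun κ hκ => ⟨mem_univ _, hκ⟩
  have hcauchy : ∀ n, ∀ ζ : E₁, ∀ τ : ℝ, 0 < τ → τ * ‖ζ‖ < d → ∀ κ ∈ N,
      ‖a n (ζ, κ)‖ ≤ ρ * τ⁻¹ ^ n := by
    intro n ζ τ hτ hτζ
    refine hmax _ (haN n ζ) _ fun κ hκ => ?_
    have hmaps : ∀ t ∈ closedBall (0 : ℂ) τ, t • ζ ∈ ball (0 : E₁) d := by
      intro t ht
      rw [mem_closedBall_zero_iff] at ht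
      rw [mem_ball_zero_iff, norm_smul]
      exact (mul_le_mul_of_nonneg_right ht (norm_nonneg _)).trans_lt hτζ
    have hdiff : DifferentiableOn ℂ (fun t => Φ (t, (ζ, κ))) (closedBall 0 τ) :=
      (huM κ hκ).comp (f := fun t : ℂ => t • ζ) (by fun_prop) hmaps
    have h := Complex.norm_iteratedDeriv_le_of_forall_mem_sphere_norm_le n hτ
      (hdiff.mono closure_ball_subset_closedBall).diffContOnCl
      (fun t ht => hbound κ hκ _ (hmaps t (sphere_subset_closedBall ht)))
    have hn : (0 : ℝ) < n.factorial := by positivity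
    calc ‖a n (ζ, κ)‖ = (n.factorial : ℝ)⁻¹ * ‖iteratedDeriv n (fun t => Φ (t, (ζ, κ))) 0‖ := by
          simp [a, norm_smul]
      _ ≤ (n.factorial : ℝ)⁻¹ * (n.factorial * ρ / τ ^ n) := by gcongr
      _ = ρ * τ⁻¹ ^ n := by rw [inv_pow]; field_simp
  let F : E₁ × E₂ → H := fun p => ∑' n, a n p
  have hFdiff : DifferentiableOn ℂ F (ball 0 d ×ˢ N) := by
    rintro p ⟨hp1, hp2⟩
    rw [mem_ball_zero_iff] at hp1
    obtain ⟨d', hd'1, hd'2⟩ := exists_between hp1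
    have hd'0 : 0 < d' := (norm_nonneg _).trans_lt hd'1
    obtain ⟨d'', hd''1, hd''2⟩ := exists_between hd'2
    have hτ : 1 < d'' / d' := (one_lt_div hd'0).2 hd''1
    have hlim : TendstoUniformlyOn (fun k p => ∑ n ∈ Finset.range k, a n p) F atTop
        (ball 0 d' ×ˢ N) := by
      refine tendstoUniformlyOn_tsum_nat (u := fun n => ρ * (d'' / d')⁻¹ ^ n)
        ((summable_geometric_of_lt_one (by positivity) (inv_lt_one_of_one_lt₀ hτ)).mul_left ρ) ?_
      rintro n ⟨ζ, κ⟩ ⟨hζ, hκ⟩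
      refine hcauchy n ζ _ (by positivity) ?_ κ hκ
      rw [mem_ball_zero_iff] at hζ
      calc d'' / d' * ‖ζ‖ ≤ d'' / d' * d' := by gcongr
        _ = d'' := by field_simp
        _ < d := hd''2
    have hopen : IsOpen (ball (0 : E₁) d' ×ˢ N) := isOpen_ball.prod hN
    have h := TendstoUniformlyOn.differentiableOn_complex hopen (fun k => ?_) hlim
    · exact (h.differentiableAt (hopen.mem_nhds
        ⟨mem_ball_zero_iff.2 hd'1, hp2⟩)).differentiableWithinAt
    · exact DifferentiableOn.fun_sum fun n _ => (ha n).mono (prod_mono (subset_univ _) subset_rfl)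
  have htaylor : ∀ ζ κ, ∀ d' : ℝ, ζ ∈ ball (0 : E₁) d' → 0 < d' →
      DifferentiableOn ℂ (fun ζ => u (ζ, κ)) (ball 0 d') → F (ζ, κ) = u (ζ, κ) := by
    intro ζ κ d' hζ hd' hdiff
    rw [mem_ball_zero_iff] at hζ
    obtain ⟨τ, hτ1, hτ⟩ : ∃ τ : ℝ, 1 < τ ∧ τ * ‖ζ‖ < d' := by
      have hc : Tendsto (fun τ : ℝ => τ * ‖ζ‖) (𝓝[>] 1) (𝓝 (1 * ‖ζ‖)) :=
        ((continuous_id.mul continuous_const).tendsto 1).mono_left nhdsWithin_le_nhds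
      rw [one_mul] at hc
      obtain ⟨τ, h1, h2⟩ := ((hc.eventually (gt_mem_nhds hζ)).and self_mem_nhdsWithin).exists
      exact ⟨τ, h2, h1⟩
    have hline : DifferentiableOn ℂ (fun t => Φ (t, (ζ, κ))) (ball 0 τ) := by
      refine hdiff.comp (f := fun t : ℂ => t • ζ) (by fun_prop) fun t ht => ?_
      rw [mem_ball_zero_iff] at ht ⊢
      rw [norm_smul]
      exact (mul_le_mul_of_nonneg_right ht.le (norm_nonneg _)).trans_lt hτ
    have h := Complex.taylorSeries_eq_on_ball hline (z := 1) (by simpa using hτ1)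
    simpa [Φ, F, a] using h
  refine ⟨F, hFdiff, ?_, ?_⟩
  · rintro ⟨ζ, κ⟩ ⟨hζ, hκ⟩
    refine hmax (fun κ => F (ζ, κ)) ?_ ρ (fun κ hκ => ?_) κ hκ
    · exact hFdiff.comp (f := fun κ : E₂ => (ζ, κ)) (by fun_prop) fun κ hκ => ⟨hζ, hκ⟩
    · rw [htaylor ζ κ d hζ hd (huM κ hκ)]
      exact hbound κ hκ ζ hζ
  · rintro ⟨ζ, κ⟩ ⟨hζ, hκ⟩
    exact htaylor ζ κ s hζ hs
      (hu.comp (f := fun ζ : E₁ => (ζ, κ)) (by fun_prop) fun ζ hζ => ⟨hζ, hκ⟩)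

/-- Propagation for maps into a manifold: in the situation of
`exists_differentiableOn_ball_prod_of_norming`, read in a chart, the expansion stays in a closed
ball inside the image of the chart, so it defines a holomorphic map to the manifold, which is the
given one by the identity theorem. -/
theorem mdifferentiableAt_of_norming {E₁ E₂ H X : Type*} [NormedAddCommGroup E₁]
    [NormedSpace ℂ E₁] [NormedAddCommGroup E₂] [NormedSpace ℂ E₂] [NormedAddCommGroup H]
    [NormedSpace ℂ H] [CompleteSpace H] [TopologicalSpace X] [T2Space X] [ChartedSpace H X]
    [IsManifold 𝓘(ℂ, H) 1 X] {e : OpenPartialHomeomorph X H} (he : e ∈ atlas H X) {c : H} {ρ : ℝ}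
    (hρ : closedBall c ρ ⊆ e.target) {G : E₁ × E₂ → X} {o : E₁} {s d : ℝ} (hs : 0 < s)
    (hsd : s ≤ d) {N M : Set E₂} (hN : IsOpen N) (hMN : M ⊆ N)
    (hG : ∀ ζ ∈ ball o s, ∀ κ ∈ N, MDifferentiableAt 𝓘(ℂ, E₁ × E₂) 𝓘(ℂ, H) G (ζ, κ) ∧
      G (ζ, κ) ∈ e.source ∩ e ⁻¹' ball c ρ)
    (hslice : ∀ κ ∈ N, MDifferentiableOn 𝓘(ℂ, E₁) 𝓘(ℂ, H) (fun ζ => G (ζ, κ)) (ball o d))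
    (hGM : ∀ κ ∈ M, ∀ ζ ∈ ball o d, G (ζ, κ) ∈ e.source ∩ e ⁻¹' ball c ρ)
    (hmax : ∀ v : E₂ → H, DifferentiableOn ℂ v N → ∀ C : ℝ, (∀ κ ∈ M, ‖v κ‖ ≤ C) →
      ∀ κ ∈ N, ‖v κ‖ ≤ C) :
    ∀ ζ ∈ ball o d, ∀ κ ∈ N, MDifferentiableAt 𝓘(ℂ, E₁ × E₂) 𝓘(ℂ, H) G (ζ, κ) := by
  have hd : 0 < d := hs.trans_le hsd
  have hshift : ∀ {δ : ℝ} {ζ : E₁}, ζ ∈ ball 0 δ → o + ζ ∈ ball o δ := by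
    intro δ ζ hζ
    simpa [mem_ball, dist_eq_norm] using hζ
  have hshift' : ∀ {δ : ℝ} {ζ : E₁}, ζ ∈ ball o δ → ζ - o ∈ ball 0 δ := by
    intro δ ζ hζ
    simpa [mem_ball, dist_eq_norm] using hζ
  let u : E₁ × E₂ → H := fun p => e (G (o + p.1, p.2)) - c
  have hu : DifferentiableOn ℂ u (ball 0 s ×ˢ N) := by
    rintro ⟨ζ, κ⟩ ⟨hζ, hκ⟩
    obtain ⟨h1, h2, -⟩ := hG _ (hshift hζ) κ hκ
    have h3 : MDifferentiableAt 𝓘(ℂ, E₁ × E₂) 𝓘(ℂ, E₁ × E₂)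
        (fun p : E₁ × E₂ => (o + p.1, p.2)) (ζ, κ) :=
      mdifferentiableAt_iff_differentiableAt.2 (by fun_prop)
    have h4 := (mdifferentiableAt_atlas (I := 𝓘(ℂ, H)) he h2).comp (ζ, κ) (h1.comp (ζ, κ) h3)
    exact ((mdifferentiableAt_iff_differentiableAt.1 h4).sub_const c).differentiableWithinAt
  have huM : ∀ κ ∈ M, DifferentiableOn ℂ (fun ζ => u (ζ, κ)) (ball 0 d) := by
    intro κ hκ ζ hζ
    have h1 := (hslice κ (hMN hκ)).mdifferentiableAt (isOpen_ball.mem_nhds (hshift hζ))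
    have h3 : MDifferentiableAt 𝓘(ℂ, E₁) 𝓘(ℂ, E₁) (fun p : E₁ => o + p) ζ :=
      mdifferentiableAt_iff_differentiableAt.2 (by fun_prop)
    have h4 := (mdifferentiableAt_atlas (I := 𝓘(ℂ, H)) he (hGM κ hκ _ (hshift hζ)).1).comp ζ
      (MDifferentiableAt.comp (g := fun ζ => G (ζ, κ)) ζ h1 h3)
    exact ((mdifferentiableAt_iff_differentiableAt.1 h4).sub_const c).differentiableWithinAt
  have huρ : ∀ κ ∈ M, ∀ ζ ∈ ball (0 : E₁) d, ‖u (ζ, κ)‖ ≤ ρ := by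
    intro κ hκ ζ hζ
    have h := (hGM κ hκ _ (hshift hζ)).2
    rw [mem_preimage, mem_ball, dist_eq_norm] at h
    exact h.le
  obtain ⟨F, hF, hFρ, hFu⟩ :=
    exists_differentiableOn_ball_prod_of_norming hs hsd hN hu huM huρ hmax
  let G' : E₁ × E₂ → X := fun p => e.symm (c + F (p.1 - o, p.2))
  have hG' : ∀ ζ ∈ ball o d, ∀ κ ∈ N, MDifferentiableAt 𝓘(ℂ, E₁ × E₂) 𝓘(ℂ, H) G' (ζ, κ) := by
    intro ζ hζ κ hκ
    have h1 : c + F (ζ - o, κ) ∈ e.target := by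
      refine hρ ?_
      rw [mem_closedBall, dist_eq_norm, add_sub_cancel_left]
      exact hFρ _ ⟨hshift' hζ, hκ⟩
    have h2 : DifferentiableAt ℂ F (ζ - o, κ) :=
      hF.differentiableAt ((isOpen_ball.prod hN).mem_nhds ⟨hshift' hζ, hκ⟩)
    have h3 : DifferentiableAt ℂ (fun p : E₁ × E₂ => c + F (p.1 - o, p.2)) (ζ, κ) :=
      (h2.comp (ζ, κ) (f := fun p : E₁ × E₂ => (p.1 - o, p.2)) (by fun_prop)).const_add c
    exact (mdifferentiableAt_atlas_symm (I := 𝓘(ℂ, H)) he h1).comp (ζ, κ)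
      (mdifferentiableAt_iff_differentiableAt.2 h3)
  have heq : EqOn G G' (ball o d ×ˢ N) := by
    rintro ⟨ζ, κ⟩ ⟨hζ, hκ⟩
    refine Convex.eqOn_of_mdifferentiableOn (F := fun ζ => G (ζ, κ)) (G := fun ζ => G' (ζ, κ))
      isOpen_ball (convex_ball o d) (hslice κ hκ) (fun ζ hζ => ?_) (mem_ball_self hd) ?_ hζ
    · have h3 : MDifferentiableAt 𝓘(ℂ, E₁) 𝓘(ℂ, E₁ × E₂) (fun ζ : E₁ => (ζ, κ)) ζ :=
        mdifferentiableAt_iff_differentiableAt.2 (by fun_prop)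
      exact (MDifferentiableAt.comp (g := G') ζ (hG' ζ hζ κ hκ) h3).mdifferentiableWithinAt
    · filter_upwards [ball_mem_nhds o hs] with ζ hζ
      have h := hFu (show (ζ - o, κ) ∈ ball 0 s ×ˢ N from ⟨hshift' hζ, hκ⟩)
      simp only [G', h, u, add_sub_cancel]
      exact (e.left_inv (hG ζ hζ κ hκ).2.1).symm
  intro ζ hζ κ hκ
  exact (hG' ζ hζ κ hκ).congr_of_eventuallyEq
    (heq.eventuallyEq_of_mem ((isOpen_ball.prod hN).mem_nhds ⟨hζ, hκ⟩))

/-! ### A Baire category argument -/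

/-- A second countable manifold is covered by countably many preimages of balls under charts. The
closed balls lie in the images of the charts, so that limits of maps into the balls, read in the
charts, still define maps to the manifold. -/
theorem exists_countable_cover_chart_balls (H X : Type*) [NormedAddCommGroup H]
    [TopologicalSpace X] [SecondCountableTopology X] [ChartedSpace H X] :
    ∃ (S : Set X) (ρ : X → ℝ), S.Countable ∧
      (∀ x, closedBall (chartAt H x x) (ρ x) ⊆ (chartAt H x).target) ∧
      ∀ y, ∃ x ∈ S, y ∈ (chartAt H x).source ∩ chartAt H x ⁻¹' ball (chartAt H x x) (ρ x) := by
  have h : ∀ x : X, ∃ ρ > 0, closedBall (chartAt H x x) ρ ⊆ (chartAt H x).target := fun x =>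
    Metric.nhds_basis_closedBall.mem_iff.1
      ((chartAt H x).open_target.mem_nhds (mem_chart_target H x))
  choose ρ hρ hsub using h
  obtain ⟨S, hS, hcov⟩ := TopologicalSpace.countable_cover_nhds
    (f := fun x : X => (chartAt H x).source ∩ chartAt H x ⁻¹' ball (chartAt H x x) (ρ x))
    fun x => ((chartAt H x).isOpen_inter_preimage isOpen_ball).mem_nhds
      ⟨mem_chart_source H x, mem_ball_self (hρ x)⟩
  refine ⟨S, ρ, hS, hsub, fun y => ?_⟩
  obtain ⟨x, hx, hy⟩ := mem_iUnion₂.1 (hcov.symm ▸ mem_univ y)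
  exact ⟨x, hx, hy⟩

/-- If `G` is holomorphic in `ζ ∈ Y` for each parameter `κ ∈ N` and jointly holomorphic for `ζ` in
a nonempty open part `A` of `Y`, then for some parameter `κ` it is jointly holomorphic near `(ζ, κ)`
for all `ζ ∈ Y`.

For each ball `b` of a countable basis and each chart ball `W` of a countable cover, consider the
parameters `κ` for which `G (·, κ)` maps `b` into `W`. A parameter outside the frontiers of the
closures of all these sets has the required property. -/
theorem exists_forall_eventually_mdifferentiableAt {E₁ E₂ H X : Type*} [NormedAddCommGroup E₁]
    [NormedSpace ℂ E₁] [TopologicalSpace.SeparableSpace E₁] [NormedAddCommGroup E₂]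
    [NormedSpace ℂ E₂] [CompleteSpace E₂] [NormedAddCommGroup H]
    [NormedSpace ℂ H] [CompleteSpace H] [TopologicalSpace X] [T2Space X]
    [SecondCountableTopology X] [ChartedSpace H X]
    [IsManifold 𝓘(ℂ, H) 1 X] {G : E₁ × E₂ → X} {Y A : Set E₁} (hY : IsOpen Y)
    (hYconv : Convex ℝ Y) (hA : IsOpen A) (hAY : A ⊆ Y) (hAne : A.Nonempty) {N : Set E₂}
    (hN : IsOpen N) (hNne : N.Nonempty)
    (hGA : MDifferentiableOn 𝓘(ℂ, E₁ × E₂) 𝓘(ℂ, H) G (A ×ˢ N))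
    (hG : ∀ κ ∈ N, MDifferentiableOn 𝓘(ℂ, E₁) 𝓘(ℂ, H) (fun ζ => G (ζ, κ)) Y) :
    ∃ κ ∈ N, ∀ ζ ∈ Y, ∀ᶠ p in 𝓝 (ζ, κ), MDifferentiableAt 𝓘(ℂ, E₁ × E₂) 𝓘(ℂ, H) G p := by
  obtain ⟨S, ρ, hS, hρ, hcov⟩ := exists_countable_cover_chart_balls H X
  let W : X → Set X := fun x =>
    (chartAt H x).source ∩ chartAt H x ⁻¹' ball (chartAt H x x) (ρ x)
  have hW : ∀ x, IsOpen (W x) := fun x => (chartAt H x).isOpen_inter_preimage isOpen_ball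
  let b : ℕ × ℕ → Set E₁ := fun i =>
    ball (TopologicalSpace.denseSeq E₁ i.1) (1 / ((i.2 : ℝ) + 1))
  let P : (ℕ × ℕ) × S → Set E₂ := fun i => {κ | ∀ ζ ∈ b i.1, G (ζ, κ) ∈ W i.2}
  have : Countable S := hS
  obtain ⟨κ, hκN, hκ⟩ : ∃ κ ∈ N, ∀ i, κ ∉ frontier (closure (P i)) := by
    have hdense : Dense (⋂ i, (frontier (closure (P i)))ᶜ) :=
      dense_iInter_of_isOpen (fun i => isClosed_frontier.isOpen_compl) fun i =>
        interior_eq_empty_iff_dense_compl.1 (interior_frontier isClosed_closure)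
    obtain ⟨κ, h1, h2⟩ := hdense.inter_open_nonempty N hN hNne
    exact ⟨κ, h1, by simpa using h2⟩
  refine ⟨κ, hκN, ?_⟩
  let T : Set E₁ :=
    {ζ | ∀ᶠ p in 𝓝 (ζ, κ), MDifferentiableAt 𝓘(ℂ, E₁ × E₂) 𝓘(ℂ, H) G p}
  have hT : IsOpen T :=
    (isOpen_setOfPred_eventually_nhds (p := fun p =>
      MDifferentiableAt 𝓘(ℂ, E₁ × E₂) 𝓘(ℂ, H) G p)).preimage
        (by fun_prop : Continuous fun ζ : E₁ => (ζ, κ))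
  refine hYconv.isPreconnected.subset_of_closure_inter_subset hT ?_ ?_
  · obtain ⟨a, ha⟩ := hAne
    refine ⟨a, hAY ha, ?_⟩
    filter_upwards [(hA.prod hN).mem_nhds (show (a, κ) ∈ A ×ˢ N from ⟨ha, hκN⟩)] with p hp
    exact hGA.mdifferentiableAt ((hA.prod hN).mem_nhds hp)
  rintro ζ₀ ⟨hζT, hζY⟩
  obtain ⟨x, hxS, hx⟩ := hcov (G (ζ₀, κ))
  obtain ⟨i, hiζ, hiY, hiW⟩ : ∃ i, ζ₀ ∈ b i ∧ b i ⊆ Y ∧ ∀ ζ ∈ b i, G (ζ, κ) ∈ W x := by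
    have hcont : ContinuousAt (fun ζ => G (ζ, κ)) ζ₀ :=
      ((hG κ hκN).mdifferentiableAt (hY.mem_nhds hζY)).continuousAt
    obtain ⟨ε, hε, hball⟩ := Metric.eventually_nhds_iff_ball.1
      ((hcont.eventually ((hW x).mem_nhds hx)).and (hY.mem_nhds hζY))
    obtain ⟨m, hm⟩ := exists_nat_one_div_lt (half_pos hε)
    obtain ⟨n, hn⟩ := (TopologicalSpace.denseRange_denseSeq E₁).exists_dist_lt ζ₀
      (Nat.one_div_pos_of_nat (α := ℝ) (n := m))
    have hsub : b (n, m) ⊆ ball ζ₀ ε := by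
      refine ball_subset_ball' ?_
      rw [dist_comm]
      dsimp only
      linarith
    exact ⟨(n, m), hn, fun ζ hζ => (hball ζ (hsub hζ)).2, fun ζ hζ => (hball ζ (hsub hζ)).1⟩
  have hκint : κ ∈ interior (closure (P (i, ⟨x, hxS⟩))) := by
    have h1 : κ ∈ closure (P (i, ⟨x, hxS⟩)) := subset_closure hiW
    by_contra h2
    exact hκ (i, ⟨x, hxS⟩) ⟨subset_closure h1, h2⟩
  obtain ⟨d, hd, hdb⟩ : ∃ d > 0, ball ζ₀ (2 * d) ⊆ b i := by
    obtain ⟨d, hd, h⟩ := Metric.isOpen_iff.1 isOpen_ball ζ₀ hiζ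
    exact ⟨d / 2, by positivity, by rwa [mul_div_cancel₀ _ two_ne_zero]⟩
  obtain ⟨o, hoT, hod⟩ := Metric.mem_closure_iff.1 hζT d hd
  have hoT' : ∀ᶠ p in 𝓝 (o, κ), MDifferentiableAt 𝓘(ℂ, E₁ × E₂) 𝓘(ℂ, H) G p := hoT
  have hob : ball o d ⊆ b i :=
    (ball_subset_ball' (by rw [dist_comm o]; linarith)).trans hdb
  have hoW : ∀ᶠ p in 𝓝 (o, κ), G p ∈ W x :=
    hoT'.self_of_nhds.continuousAt.eventually
      ((hW x).mem_nhds (hiW o (hob (mem_ball_self hd))))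
  obtain ⟨δ, hδ, hball⟩ := Metric.eventually_nhds_iff_ball.1 (hoT'.and hoW)
  rw [← ball_prod_same] at hball
  let N' : Set E₂ := ball κ δ ∩ interior (closure (P (i, ⟨x, hxS⟩))) ∩ N
  have hN' : IsOpen N' := (isOpen_ball.inter isOpen_interior).inter hN
  have hprop := mdifferentiableAt_of_norming (chart_mem_atlas H x) (hρ x) (G := G) (o := o)
    (s := min δ d) (d := d) (N := N') (M := P (i, ⟨x, hxS⟩) ∩ N') (lt_min hδ hd)
    (min_le_right _ _) hN' inter_subset_right
    (fun ζ hζ κ hκ => hball (ζ, κ) ⟨ball_subset_ball (min_le_left _ _) hζ, hκ.1.1⟩)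
    (fun κ hκ => (hG κ hκ.2).mono (hob.trans hiY))
    (fun κ hκ ζ hζ => hκ.1 ζ (hob hζ)) ?_
  · filter_upwards [(isOpen_ball.prod hN').mem_nhds
      (show (ζ₀, κ) ∈ ball o d ×ˢ N' from ⟨hod, ⟨mem_ball_self hδ, hκint⟩, hκN⟩)] with p hp
    exact hprop p.1 hp.1 p.2 hp.2
  · -- the parameters in `P` are dense in `N'`, so a bound extends by continuity
    intro v hv C hC κ' hκ'
    by_contra! hlt
    have h1 : ∀ᶠ κ in 𝓝 κ', C < ‖v κ‖ :=
      (hv.continuousOn.continuousAt (hN'.mem_nhds hκ')).norm.eventually (lt_mem_nhds hlt)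
    obtain ⟨κ'', h2, h3, h4⟩ := ((mem_closure_iff_frequently.1
      (interior_subset hκ'.1.2)).and_eventually (h1.and (hN'.mem_nhds hκ'))).exists
    exact (hC κ'' ⟨h2, h4⟩).not_gt h3

/-! ### A Hartogs theorem for maps holomorphic on lines -/

/-- A map `g` is holomorphic on `D × B` if it is holomorphic on `A × B` for a nonempty open `A ⊆ D`
and, for each `w₁ ∈ B` and all small `κ`, it is holomorphic on the product of `D` with a disc about
`0` of radius greater than `1` in the complex line through `κ` and `w₁`.

The Baire argument provides a `κ` such that `g` is holomorphic near `D × {w}` for the points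
`w ≠ w₁` of that disc, with uniform control on a cone with vertex `w₁`. The maximum principle on
discs parallel to this line, whose boundaries lie in the cone, carries the bounds from the cone to a
neighbourhood of `w₁`. -/
theorem mdifferentiableOn_prod_of_lines {E₁ E₂ H X : Type*} [NormedAddCommGroup E₁]
    [NormedSpace ℂ E₁] [TopologicalSpace.SeparableSpace E₁] [NormedAddCommGroup E₂]
    [NormedSpace ℂ E₂] [CompleteSpace E₂] [NormedAddCommGroup H]
    [NormedSpace ℂ H] [CompleteSpace H] [TopologicalSpace X] [T2Space X]
    [SecondCountableTopology X] [ChartedSpace H X]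
    [IsManifold 𝓘(ℂ, H) 1 X] {g : E₁ × E₂ → X} {D A : Set E₁} {B : Set E₂} (hD : IsOpen D)
    (hDconv : Convex ℝ D) (hA : IsOpen A) (hAD : A ⊆ D) (hAne : A.Nonempty) (hB : IsOpen B)
    (hgA : MDifferentiableOn 𝓘(ℂ, E₁ × E₂) 𝓘(ℂ, H) g (A ×ˢ B))
    (hlines : ∀ w ∈ B, ∃ R > (1 : ℝ), ∃ η > (0 : ℝ), ∀ κ ∈ ball (0 : E₂) η,
      (∀ l ∈ ball (0 : ℂ) R, l • w + (1 - l) • κ ∈ B) ∧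
      MDifferentiableOn 𝓘(ℂ, E₁ × ℂ) 𝓘(ℂ, H)
        (fun p : E₁ × ℂ => g (p.1, p.2 • w + (1 - p.2) • κ)) (D ×ˢ ball 0 R)) :
    MDifferentiableOn 𝓘(ℂ, E₁ × E₂) 𝓘(ℂ, H) g (D ×ˢ B) := by
  have hslice : ∀ w ∈ B, MDifferentiableOn 𝓘(ℂ, E₁) 𝓘(ℂ, H) (fun z => g (z, w)) D := by
    intro w hw z hz
    obtain ⟨R, hR, η, hη, h⟩ := hlines w hw
    have h1 := (h 0 (mem_ball_self hη)).2.mdifferentiableAt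
      ((hD.prod isOpen_ball).mem_nhds (show (z, (1 : ℂ)) ∈ _ from ⟨hz, by simpa using hR⟩))
    have h3 : MDifferentiableAt 𝓘(ℂ, E₁) 𝓘(ℂ, E₁ × ℂ) (fun z : E₁ => (z, (1 : ℂ))) z :=
      mdifferentiableAt_iff_differentiableAt.2 (by fun_prop)
    simpa [Function.comp_def] using (h1.comp z h3).mdifferentiableWithinAt
  suffices key : ∀ w ∈ B, ∀ z ∈ D,
      ∀ᶠ p in 𝓝 (z, w), MDifferentiableAt 𝓘(ℂ, E₁ × E₂) 𝓘(ℂ, H) g p from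
    fun p hp => (key p.2 hp.2 p.1 hp.1).self_of_nhds.mdifferentiableWithinAt
  intro w hw
  obtain ⟨R, hR, η, hη, hline⟩ := hlines w hw
  let G : (E₁ × ℂ) × E₂ → X := fun p => g (p.1.1, p.1.2 • w + (1 - p.1.2) • p.2)
  obtain ⟨κ, hκ, hGκ⟩ := exists_forall_eventually_mdifferentiableAt (G := G)
    (Y := D ×ˢ ball (0 : ℂ) R) (A := A ×ˢ ball (0 : ℂ) R) (N := ball 0 η) (hD.prod isOpen_ball)
    (hDconv.prod (convex_ball _ _)) (hA.prod isOpen_ball) (prod_mono hAD subset_rfl)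
    (hAne.prod ⟨0, mem_ball_self (by linarith)⟩) isOpen_ball ⟨0, mem_ball_self hη⟩
    (by
      rintro p ⟨hp1, hp2⟩
      have h1 := hgA.mdifferentiableAt ((hA.prod hB).mem_nhds
        (show (p.1.1, p.1.2 • w + (1 - p.1.2) • p.2) ∈ _ from
          ⟨hp1.1, (hline p.2 hp2).1 _ hp1.2⟩))
      have h3 : MDifferentiableAt 𝓘(ℂ, (E₁ × ℂ) × E₂) 𝓘(ℂ, E₁ × E₂)
          (fun p : (E₁ × ℂ) × E₂ => (p.1.1, p.1.2 • w + (1 - p.1.2) • p.2)) p :=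
        mdifferentiableAt_iff_differentiableAt.2 (by fun_prop)
      exact (MDifferentiableAt.comp (g := g) p h1 h3).mdifferentiableWithinAt)
    (fun κ hκ => (hline κ hκ).2)
  let T : Set E₁ :=
    {z | ∀ᶠ p in 𝓝 (z, w), MDifferentiableAt 𝓘(ℂ, E₁ × E₂) 𝓘(ℂ, H) g p}
  have hT : IsOpen T :=
    (isOpen_setOfPred_eventually_nhds (p := fun p =>
      MDifferentiableAt 𝓘(ℂ, E₁ × E₂) 𝓘(ℂ, H) g p)).preimage
        (by fun_prop : Continuous fun z : E₁ => (z, w))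
  refine hDconv.isPreconnected.subset_of_closure_inter_subset hT ?_ ?_
  · obtain ⟨a, ha⟩ := hAne
    refine ⟨a, hAD ha, ?_⟩
    filter_upwards [(hA.prod hB).mem_nhds (show (a, w) ∈ A ×ˢ B from ⟨ha, hw⟩)] with p hp
    exact hgA.mdifferentiableAt ((hA.prod hB).mem_nhds hp)
  rintro z₀ ⟨hzT, hzD⟩
  obtain ⟨S, ρ, -, hρ, hcov⟩ := exists_countable_cover_chart_balls H X
  obtain ⟨x, -, hx⟩ := hcov (g (z₀, w))
  let W : Set X := (chartAt H x).source ∩ chartAt H x ⁻¹' ball (chartAt H x x) (ρ x)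
  have hW : IsOpen W := (chartAt H x).isOpen_inter_preimage isOpen_ball
  -- near the parameter `κ`, the map sends the cone with vertex `w` into the chart ball `W`
  obtain ⟨ε, hε, hcone, hεD⟩ : ∃ ε > 0, (∀ z ∈ ball z₀ ε, ∀ l ∈ ball (1 : ℂ) ε,
      ∀ κ' ∈ ball κ ε, g (z, l • w + (1 - l) • κ') ∈ W) ∧ ball z₀ ε ⊆ D := by
    have h1 := (hGκ (z₀, 1) ⟨hzD, by simpa using hR⟩).self_of_nhds.continuousAt
    have h2 : ∀ᶠ p in 𝓝 ((z₀, (1 : ℂ)), κ), G p ∈ W :=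
      h1.eventually (hW.mem_nhds (by simpa [G, W] using hx))
    obtain ⟨ε, hε, h⟩ := Metric.eventually_nhds_iff_ball.1 h2
    obtain ⟨ε', hε', h'⟩ := Metric.isOpen_iff.1 hD z₀ hzD
    rw [← ball_prod_same, ← ball_prod_same] at h
    refine ⟨min ε ε', lt_min hε hε', fun z hz l hl κ' hκ' => h ((z, l), κ') ?_,
      (ball_subset_ball (min_le_right _ _)).trans h'⟩
    have hle := ball_subset_ball (x := z₀) (min_le_left ε ε')
    exact ⟨⟨hle hz, ball_subset_ball (min_le_left ε ε') hl⟩,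
      ball_subset_ball (min_le_left ε ε') hκ'⟩
  set d : ℝ := ε / 2 with hd_def
  have hd : 0 < d := by positivity
  obtain ⟨o, hoT, hod⟩ := Metric.mem_closure_iff.1 hzT d hd
  have hoT' : ∀ᶠ p in 𝓝 (o, w), MDifferentiableAt 𝓘(ℂ, E₁ × E₂) 𝓘(ℂ, H) g p := hoT
  have hob : ball o d ⊆ ball z₀ ε := ball_subset_ball' (by rw [dist_comm o]; linarith)
  have howW : g (o, w) ∈ W := by
    have h := hcone o (hob (mem_ball_self hd)) 1 (mem_ball_self hε) κ (mem_ball_self hε)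
    simpa using h
  obtain ⟨δ, hδ, hball⟩ := Metric.eventually_nhds_iff_ball.1 ((hoT'.and
    (hoT'.self_of_nhds.continuousAt.eventually (hW.mem_nhds howW))).and
      ((continuous_snd.tendsto (o, w)).eventually (hB.mem_nhds hw)))
  rw [← ball_prod_same] at hball
  have hballB : ball w δ ⊆ B := fun w' hw' => (hball (o, w') ⟨mem_ball_self hδ, hw'⟩).2
  -- a tube around a small disc about `w` in the line through `w` and `κ`
  set h : E₂ := w - κ with hh
  obtain ⟨ε₁, hε₁, hε₁ε, hε₁δ⟩ : ∃ ε₁ > 0, ε₁ < ε ∧ ε₁ * ‖h‖ < δ / 2 := by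
    refine ⟨min (ε / 2) (δ / 4 / (‖h‖ + 1)), by positivity, ?_, ?_⟩
    · exact (min_le_left _ _).trans_lt (half_lt_self hε)
    · calc min (ε / 2) (δ / 4 / (‖h‖ + 1)) * ‖h‖ ≤ δ / 4 / (‖h‖ + 1) * (‖h‖ + 1) := by
            gcongr
            · exact min_le_right _ _
            · linarith
        _ = δ / 4 := by field_simp
        _ < δ / 2 := by linarith
  obtain ⟨ν, hν, hνδ, hνε⟩ : ∃ ν > 0, ν ≤ δ / 2 ∧ 2 * ν / ε₁ ≤ ε := by
    refine ⟨min (δ / 2) (ε * ε₁ / 2), by positivity, min_le_left _ _, ?_⟩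
    rw [div_le_iff₀ hε₁]
    linarith [min_le_right (δ / 2) (ε * ε₁ / 2)]
  let N : Set E₂ := ⋃ μ ∈ ball (0 : ℂ) ε₁, ball (w + μ • h) ν
  have hN : IsOpen N := isOpen_biUnion fun _ _ => isOpen_ball
  have hNδ : N ⊆ ball w δ := by
    refine iUnion₂_subset fun μ hμ => ball_subset_ball' ?_
    rw [mem_ball_zero_iff] at hμ
    rw [dist_eq_norm, add_sub_cancel_left, norm_smul]
    have : ‖μ‖ * ‖h‖ ≤ ε₁ * ‖h‖ := by gcongr
    linarith
  let M : Set E₂ := {w' | w' ∈ N ∧ ∀ z ∈ ball o d, g (z, w') ∈ W}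
  have hMcone : ∀ k ∈ ball (0 : E₂) ν, ∀ μ ∈ ball (0 : ℂ) ε₁, ε₁ / 2 ≤ ‖μ‖ →
      w + μ • h + k ∈ M := by
    intro k hk μ hμ hμ'
    rw [mem_ball_zero_iff] at hk hμ
    refine ⟨mem_iUnion₂.2 ⟨μ, by simpa using hμ, by simpa [dist_eq_norm] using hk⟩, ?_⟩
    intro z hz
    have hμ0 : μ ≠ 0 := by rw [← norm_pos_iff]; linarith
    -- `w + μ • h + k` lies on the line through `w` and `κ - μ⁻¹ • k`, with parameter `1 + μ`
    have hmem := hcone z (hob hz) (1 + μ) (by simpa [dist_eq_norm] using hμ.trans hε₁ε)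
      (κ - μ⁻¹ • k) ?_
    · convert hmem using 3
      rw [hh, smul_sub (1 - (1 + μ)), smul_smul]
      have : (1 - (1 + μ)) * μ⁻¹ = -1 := by field_simp; ring
      rw [this]
      module
    · rw [mem_ball, dist_eq_norm, sub_sub_cancel_left, norm_neg, norm_smul, norm_inv]
      calc ‖μ‖⁻¹ * ‖k‖ ≤ (ε₁ / 2)⁻¹ * ‖k‖ := by gcongr
        _ < (ε₁ / 2)⁻¹ * ν := by gcongr
        _ = 2 * ν / ε₁ := by field_simp
        _ ≤ ε := hνε
  have hprop := mdifferentiableAt_of_norming (chart_mem_atlas H x) (hρ x) (G := g) (o := o)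
    (s := min δ d) (d := d) (N := N) (M := M) (lt_min hδ hd) (min_le_right _ _) hN
    (fun w' hw' => hw'.1)
    (fun z hz w' hw' => (hball (z, w') ⟨ball_subset_ball (min_le_left _ _) hz, hNδ hw'⟩).1)
    (fun w' hw' => (hslice w' (hballB (hNδ hw'))).mono (hob.trans hεD))
    (fun w' hw' z hz => hw'.2 z hz) ?_
  · have hwN : w ∈ N := mem_iUnion₂.2 ⟨0, mem_ball_self hε₁, by simpa using hν⟩
    filter_upwards [(isOpen_ball.prod hN).mem_nhds
      (show (z₀, w) ∈ ball o d ×ˢ N from ⟨hod, hwN⟩)] with p hp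
    exact hprop p.1 hp.1 p.2 hp.2
  · intro v hv C hC w' hw'
    obtain ⟨μ, hμ, hw'μ⟩ := mem_iUnion₂.1 hw'
    set k : E₂ := w' - (w + μ • h) with hk_def
    have hk : k ∈ ball (0 : E₂) ν := by simpa [hk_def, dist_eq_norm] using hw'μ
    have hw'_eq : w' = w + μ • h + k := by rw [hk_def]; abel
    rcases le_or_gt (ε₁ / 2) ‖μ‖ with hle | hlt
    · exact hC w' (hw'_eq ▸ hMcone k hk μ hμ hle)
    have hlineN : ∀ μ' ∈ closedBall (0 : ℂ) (ε₁ / 2), w + μ' • h + k ∈ N := by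
      intro μ' hμ'
      rw [mem_closedBall_zero_iff] at hμ'
      exact mem_iUnion₂.2 ⟨μ', mem_ball_zero_iff.2 (by linarith),
        by simpa [dist_eq_norm] using hk⟩
    have hdiff : DifferentiableOn ℂ (fun μ' : ℂ => v (w + μ' • h + k))
        (closedBall 0 (ε₁ / 2)) :=
      hv.comp (f := fun μ' : ℂ => w + μ' • h + k) (by fun_prop) hlineN
    have hfin := Complex.norm_le_of_forall_mem_frontier_norm_le (U := ball (0 : ℂ) (ε₁ / 2))
      (C := C) isBounded_ball (hdiff.mono closure_ball_subset_closedBall).diffContOnCl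
      (fun μ' hμ' => ?_) (subset_closure (mem_ball_zero_iff.2 hlt))
    · rw [hw'_eq]
      exact hfin
    · rw [frontier_ball _ (by positivity), mem_sphere_zero_iff_norm] at hμ'
      exact hC _ (hMcone k hk μ' (mem_ball_zero_iff.2 (by linarith)) hμ'.ge)

/-! ### Polydisks, ring domains and the splitting of `l²` -/

theorem polydisk_eq_pi (q : ℕ) (r : ℝ) :
    polydisk q r = univ.pi fun _ : Fin q => ball (0 : ℂ) r := by
  ext z
  simp [polydisk]

theorem isOpen_polydisk (q : ℕ) (r : ℝ) : IsOpen (polydisk q r) := by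
  rw [polydisk_eq_pi]
  exact isOpen_set_pi finite_univ fun _ _ => isOpen_ball

theorem convex_polydisk (q : ℕ) (r : ℝ) : Convex ℝ (polydisk q r) := by
  rw [polydisk_eq_pi]
  exact convex_pi fun _ _ => convex_ball _ _

theorem isOpen_ringDomain (q : ℕ) (r₁ r₂ : ℝ) : IsOpen (ringDomain q r₁ r₂) :=
  (isOpen_polydisk q r₂).sdiff isClosed_closure

theorem ringDomain_subset_of_le {q : ℕ} {r₁ r₂ s₁ : ℝ} (h : r₁ ≤ s₁) :
    ringDomain q s₁ r₂ ⊆ ringDomain q r₁ r₂ :=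
  sdiff_subset_sdiff_right (closure_mono fun _ hz i => (hz i).trans_le h)

theorem ringDomain_nonempty {q : ℕ} (hq : 1 ≤ q) {r₁ r₂ : ℝ} (h₁ : 0 ≤ r₁) (h : r₁ < r₂) :
    (ringDomain q r₁ r₂).Nonempty := by
  obtain ⟨t, ht₁, ht₂⟩ := exists_between h
  have ht : ‖(t : ℂ)‖ = t := by rw [Complex.norm_real, Real.norm_of_nonneg (h₁.trans ht₁.le)]
  refine ⟨fun _ => t, fun _ => ht.trans_lt ht₂, fun hmem => ?_⟩
  have hclosed : IsClosed {z : Fin q → ℂ | ‖z ⟨0, hq⟩‖ ≤ r₁} :=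
    isClosed_le (by fun_prop) continuous_const
  have hle : ‖(t : ℂ)‖ ≤ r₁ :=
    closure_minimal (s := polydisk q r₁) (fun z hz => (hz ⟨0, hq⟩).le) hclosed hmem
  linarith

theorem norm_seqTail_le (q : ℕ) (x : SeqHilbert) : ‖seqTail q x‖ ≤ ‖x‖ := by
  have h2 : 0 < (2 : ENNReal).toReal := by norm_num
  refine lp.norm_le_of_forall_sum_le h2 (norm_nonneg x) fun s => ?_
  change ∑ i ∈ s, ‖x (i + q)‖ ^ (2 : ENNReal).toReal ≤ _
  simpa using lp.sum_rpow_le_norm_rpow h2 x (s.map (addRightEmbedding q))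

theorem bijective_seqHead_seqTail (q : ℕ) :
    Function.Bijective fun x : SeqHilbert => (seqHead q x, seqTail q x) := by
  constructor
  · intro x y hxy
    rw [Prod.mk.injEq] at hxy
    refine lp.ext (funext fun k => ?_)
    rcases lt_or_ge k q with hk | hk
    · exact congrFun hxy.1 ⟨k, hk⟩
    · obtain ⟨j, rfl⟩ := Nat.exists_eq_add_of_le' hk
      exact congrArg (fun u : SeqHilbert => u j) hxy.2
  · rintro ⟨z, w⟩
    have hsum : Summable fun k =>
        ‖(if h : k < q then z ⟨k, h⟩ else w (k - q) : ℂ)‖ ^ (2 : ENNReal).toReal := by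
      rw [← summable_nat_add_iff q]
      simpa using (lp.memℓp w).summable (by norm_num)
    let x : SeqHilbert := ⟨_, memℓp_gen hsum⟩
    have hx : ∀ k, x k = if h : k < q then z ⟨k, h⟩ else w (k - q) := fun _ => rfl
    refine ⟨x, Prod.ext (funext fun i => ?_) (lp.ext (funext fun k => ?_))⟩
    · simp [seqHead, hx]
    · change x (k + q) = w k
      simp [hx]

/-- The splitting of a sequence into its first `q` terms and the remaining ones, as a continuous
linear equivalence `l² ≃ ℂ^q × l²`. -/
noncomputable def seqSplit (q : ℕ) : SeqHilbert ≃L[ℂ] (Fin q → ℂ) × SeqHilbert :=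
  ContinuousLinearEquiv.ofBijective
    (LinearMap.mkContinuous
      { toFun := fun x => (seqHead q x, seqTail q x)
        map_add' := fun _ _ => rfl
        map_smul' := fun _ _ => rfl } 1 fun x => by
      rw [one_mul]
      refine max_le ?_ (norm_seqTail_le q x)
      exact (pi_norm_le_iff_of_nonneg (norm_nonneg x)).2 fun i =>
        lp.norm_apply_le_norm two_ne_zero x i)
    (LinearMap.ker_eq_bot.2 (bijective_seqHead_seqTail q).1)
    (LinearMap.range_eq_top.2 (bijective_seqHead_seqTail q).2)

theorem seqSplit_apply (q : ℕ) (x : SeqHilbert) : seqSplit q x = (seqHead q x, seqTail q x) := rfl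

theorem seqProd_eq_preimage {q : ℕ} (D : Set (Fin q → ℂ)) (B : Set SeqHilbert) :
    seqProd D B = seqSplit q ⁻¹' (D ×ˢ B) := rfl

/-! ### Extension along complex lines -/

/-- In a `q`-Hartogs manifold, a map defined over the ring domain for `‖w‖ < 1` and over the
polydisk for `‖w‖ < r` extends to the polydisk over a disc in any complex line starting at a point
`κ` with `‖κ‖ < r`. The Hartogs property gives agreement over the polydisk for small `l`, hence
over the ring domain for all `l`, by the identity theorem in `l`. -/
theorem IsHartogs.exists_extension_line {X : Type*} [TopologicalSpace X] [T2Space X]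
    [ChartedSpace SeqHilbert X] [IsManifold 𝓘(ℂ, SeqHilbert) 1 X] {q : ℕ} (hX : IsHartogs q X)
    {r : ℝ} (hr0 : 0 < r) (hr1 : r < 1) {F : (Fin q → ℂ) × SeqHilbert → X}
    (hF : MDifferentiableOn 𝓘(ℂ, (Fin q → ℂ) × SeqHilbert) 𝓘(ℂ, SeqHilbert) F
      (polydisk q 1 ×ˢ ball 0 r ∪ ringDomain q (1 - r) 1 ×ˢ ball 0 1))
    {w κ : SeqHilbert} {R : ℝ} (hR : 0 < R) (hκ : ‖κ‖ < r)
    (hline : ∀ l ∈ ball (0 : ℂ) R, l • w + (1 - l) • κ ∈ ball (0 : SeqHilbert) 1) :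
    ∃ Γ : (Fin q → ℂ) × ℂ → X,
      MDifferentiableOn 𝓘(ℂ, (Fin q → ℂ) × ℂ) 𝓘(ℂ, SeqHilbert) Γ (polydisk q 1 ×ˢ ball 0 R) ∧
      ∀ z ∈ ringDomain q (1 - r) 1, ∀ l ∈ ball (0 : ℂ) R,
        Γ (z, l) = F (z, l • w + (1 - l) • κ) := by
  have hFig : IsOpen (polydisk q 1 ×ˢ ball (0 : SeqHilbert) r ∪
      ringDomain q (1 - r) 1 ×ˢ ball (0 : SeqHilbert) 1) :=
    ((isOpen_polydisk q 1).prod isOpen_ball).union ((isOpen_ringDomain q _ 1).prod isOpen_ball)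
  obtain ⟨s, hs, hsr⟩ : ∃ s > 0, ∀ l ∈ ball (0 : ℂ) s,
      l • w + (1 - l) • κ ∈ ball (0 : SeqHilbert) r := by
    have hc : ContinuousAt (fun l : ℂ => l • w + (1 - l) • κ) 0 := by fun_prop
    refine Metric.eventually_nhds_iff_ball.1 (hc.eventually (isOpen_ball.mem_nhds ?_))
    simpa using hκ
  set r' : ℝ := min r (s / R)
  have hr'0 : 0 < r' := lt_min hr0 (div_pos hs hR)
  have hscale : ∀ {a : ℂ} {δ : ℝ}, a ∈ ball (0 : ℂ) δ → (R : ℂ) * a ∈ ball (0 : ℂ) (R * δ) := by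
    intro a δ ha
    rw [mem_ball_zero_iff] at ha ⊢
    rw [norm_mul, Complex.norm_real, Real.norm_of_nonneg hR.le]
    exact mul_lt_mul_of_pos_left ha hR
  let ψ : (Fin (q + 1) → ℂ) → (Fin q → ℂ) × SeqHilbert := fun x =>
    (fun i => x i.castSucc, ((R : ℂ) * x (Fin.last q)) • w + (1 - (R : ℂ) * x (Fin.last q)) • κ)
  have hψ : Differentiable ℂ ψ := by fun_prop
  have hψmem : ∀ x ∈ hartogsFigure q r', ψ x ∈ polydisk q 1 ×ˢ ball (0 : SeqHilbert) r ∪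
      ringDomain q (1 - r) 1 ×ˢ ball (0 : SeqHilbert) 1 := by
    rintro x (⟨h1, h2⟩ | ⟨h1, h2⟩)
    · refine Or.inl ⟨h1, hsr _ (ball_subset_ball ?_ (hscale h2))⟩
      calc R * r' ≤ R * (s / R) := by gcongr; exact min_le_right _ _
        _ = s := by field_simp
    · refine Or.inr ⟨ringDomain_subset_of_le (by linarith [min_le_left r (s / R)]) h1, hline _ ?_⟩
      simpa using hscale h2
  obtain ⟨g, hg, hgf⟩ := hX r' hr'0 ((min_le_left _ _).trans_lt hr1) (F ∘ ψ)
    (hF.comp hψ.mdifferentiable.mdifferentiableOn hψmem)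
  let σ : (Fin q → ℂ) × ℂ → Fin (q + 1) → ℂ := fun p =>
    Fin.snoc (α := fun _ => ℂ) p.1 ((R : ℂ)⁻¹ * p.2)
  have hσ : Differentiable ℂ σ := by
    refine differentiable_pi.2 fun i => ?_
    refine Fin.lastCases ?_ (fun j => ?_) i
    · simp only [σ, Fin.snoc_last]
      fun_prop
    · simp only [σ, Fin.snoc_castSucc]
      fun_prop
  have hscale' : ∀ {a : ℂ} {δ : ℝ}, a ∈ ball (0 : ℂ) (R * δ) → (R : ℂ)⁻¹ * a ∈ ball (0 : ℂ) δ := by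
    intro a δ ha
    rw [mem_ball_zero_iff] at ha ⊢
    rw [norm_mul, norm_inv, Complex.norm_real, Real.norm_of_nonneg hR.le]
    rwa [inv_mul_lt_iff₀ hR]
  have hσmem : MapsTo σ (polydisk q 1 ×ˢ ball 0 R) (polydisk (q + 1) 1) := by
    rintro ⟨z, l⟩ ⟨hz, hl⟩ i
    refine Fin.lastCases ?_ (fun j => ?_) i
    · simpa [σ] using hscale' (δ := 1) (by simpa using hl)
    · simpa [σ] using hz j
  have hψσ : ∀ z l, ψ (σ (z, l)) = (z, l • w + (1 - l) • κ) := by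
    intro z l
    have hR' : (R : ℂ) ≠ 0 := by exact_mod_cast hR.ne'
    simp [ψ, σ, mul_inv_cancel_left₀ hR']
  have hΓ : MDifferentiableOn 𝓘(ℂ, (Fin q → ℂ) × ℂ) 𝓘(ℂ, SeqHilbert) (g ∘ σ)
      (polydisk q 1 ×ˢ ball 0 R) :=
    hg.comp hσ.mdifferentiable.mdifferentiableOn hσmem
  refine ⟨g ∘ σ, hΓ, fun z hz l hl => ?_⟩
  refine Convex.eqOn_of_mdifferentiableOn (H := SeqHilbert) (F := fun l => (g ∘ σ) (z, l))
    (G := fun l => F (z, l • w + (1 - l) • κ)) isOpen_ball (convex_ball (0 : ℂ) R) ?_ ?_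
    (mem_ball_self hR) ?_ hl
  · have h1 : MDifferentiableOn 𝓘(ℂ, ℂ) 𝓘(ℂ, (Fin q → ℂ) × ℂ) (fun l : ℂ => (z, l)) (ball 0 R) :=
      mdifferentiableOn_iff_differentiableOn.2 (by fun_prop)
    exact hΓ.comp h1 fun l hl => ⟨hz.1, hl⟩
  · have h1 : MDifferentiableOn 𝓘(ℂ, ℂ) 𝓘(ℂ, (Fin q → ℂ) × SeqHilbert)
        (fun l : ℂ => (z, l • w + (1 - l) • κ)) (ball 0 R) :=
      mdifferentiableOn_iff_differentiableOn.2 (by fun_prop)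
    exact hF.comp h1 fun l hl => Or.inr ⟨hz, hline l hl⟩
  · filter_upwards [ball_mem_nhds (0 : ℂ) (mul_pos hR hr'0)] with l hl
    have hmem : σ (z, l) ∈ hartogsFigure q r' := by
      refine Or.inl ⟨?_, ?_⟩
      · simpa [σ] using hz.1
      · simpa [σ] using hscale' hl
    change g (σ (z, l)) = _
    rw [hgf hmem, Function.comp_apply, hψσ]

/-! ### Extension to `Δ^q × B^∞` -/

theorem mainTheorem2 {X : Type*} [TopologicalSpace X] [T2Space X] [SecondCountableTopology X]
    [ChartedSpace SeqHilbert X] [IsManifold 𝓘(ℂ, SeqHilbert) ω X]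
    (q : ℕ) (hq : 1 ≤ q) (hX : IsHartogs q X)
    (r : ℝ) (hr0 : 0 < r) (hr1 : r < 1) (f : SeqHilbert → X)
    (hf : MDifferentiableOn 𝓘(ℂ, SeqHilbert) 𝓘(ℂ, SeqHilbert) f (hartogsFigureInf q r)) :
    ∃ g : SeqHilbert → X,
      MDifferentiableOn 𝓘(ℂ, SeqHilbert) 𝓘(ℂ, SeqHilbert) g
        (seqProd (polydisk q 1) (Metric.ball 0 1)) ∧
      Set.EqOn g f (hartogsFigureInf q r) := by
  have : IsManifold 𝓘(ℂ, SeqHilbert) 1 X := IsManifold.of_le (n := ω) le_top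
  set D : Set (Fin q → ℂ) := polydisk q 1
  set A : Set (Fin q → ℂ) := ringDomain q (1 - r) 1
  have hDo : IsOpen D := isOpen_polydisk q 1
  have hDc : Convex ℝ D := convex_polydisk q 1
  have hAo : IsOpen A := isOpen_ringDomain q _ 1
  have hAD : A ⊆ D := sdiff_subset
  obtain ⟨a, ha⟩ : A.Nonempty := ringDomain_nonempty hq (by linarith) (by linarith)
  let F : (Fin q → ℂ) × SeqHilbert → X := f ∘ (seqSplit q).symm
  have hF : MDifferentiableOn 𝓘(ℂ, (Fin q → ℂ) × SeqHilbert) 𝓘(ℂ, SeqHilbert) F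
      (D ×ˢ ball 0 r ∪ A ×ˢ ball 0 1) := by
    refine hf.comp (seqSplit q).symm.differentiable.mdifferentiable.mdifferentiableOn ?_
    rintro p hp
    change (seqSplit q) ((seqSplit q).symm p) ∈ D ×ˢ ball 0 r ∪ A ×ˢ ball 0 1
    rwa [ContinuousLinearEquiv.apply_symm_apply]
  have hFf : ∀ x, F (seqHead q x, seqTail q x) = f x := fun x => by
    rw [← seqSplit_apply]
    simp [F]
  -- holomorphic maps that agree over the ring domain agree over the polydisk
  have huniq : ∀ u v : (Fin q → ℂ) → X, MDifferentiableOn 𝓘(ℂ, Fin q → ℂ) 𝓘(ℂ, SeqHilbert) u D →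
      MDifferentiableOn 𝓘(ℂ, Fin q → ℂ) 𝓘(ℂ, SeqHilbert) v D → EqOn u v A → EqOn u v D :=
    fun u v hu hv huv => Convex.eqOn_of_mdifferentiableOn hDo hDc hu hv (hAD ha)
      (huv.eventuallyEq_of_mem (hAo.mem_nhds ha))
  have hslice : ∀ {Γ : (Fin q → ℂ) × ℂ → X} {R : ℝ},
      MDifferentiableOn 𝓘(ℂ, (Fin q → ℂ) × ℂ) 𝓘(ℂ, SeqHilbert) Γ (D ×ˢ ball 0 R) →
      ∀ l ∈ ball (0 : ℂ) R,
        MDifferentiableOn 𝓘(ℂ, Fin q → ℂ) 𝓘(ℂ, SeqHilbert) (fun z => Γ (z, l)) D := by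
    intro Γ R hΓ l hl
    have h1 : MDifferentiableOn 𝓘(ℂ, Fin q → ℂ) 𝓘(ℂ, (Fin q → ℂ) × ℂ)
        (fun z : Fin q → ℂ => (z, l)) D :=
      mdifferentiableOn_iff_differentiableOn.2 (by fun_prop)
    exact hΓ.comp h1 fun z hz => ⟨hz, hl⟩
  have hdisc : ∀ w ∈ ball (0 : SeqHilbert) 1, ∃ R > (1 : ℝ), ∃ η > (0 : ℝ), η ≤ r ∧
      ∀ κ ∈ ball (0 : SeqHilbert) η, ∀ l ∈ ball (0 : ℂ) R,
        l • w + (1 - l) • κ ∈ ball (0 : SeqHilbert) 1 := by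
    intro w hw
    rw [mem_ball_zero_iff] at hw
    -- `R` is chosen so that `R * ‖w‖ < 1`, by continuity in `R` at `1`
    obtain ⟨R, hR1, hRw⟩ : ∃ R : ℝ, 1 < R ∧ R * ‖w‖ < 1 := by
      have hc : Tendsto (fun R : ℝ => R * ‖w‖) (𝓝[>] 1) (𝓝 (1 * ‖w‖)) :=
        ((continuous_id.mul continuous_const).tendsto 1).mono_left nhdsWithin_le_nhds
      rw [one_mul] at hc
      obtain ⟨R, h1, h2⟩ := ((hc.eventually (gt_mem_nhds hw)).and self_mem_nhdsWithin).exists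
      exact ⟨R, h2, h1⟩
    refine ⟨R, hR1, min r ((1 - R * ‖w‖) / (1 + R)),
      lt_min hr0 (div_pos (by linarith) (by linarith)), min_le_left _ _, fun κ hκ l hl => ?_⟩
    rw [mem_ball_zero_iff] at hκ hl ⊢
    have hκ' : (1 + R) * ‖κ‖ < 1 - R * ‖w‖ := by
      have h := (lt_div_iff₀ (by linarith)).1 (hκ.trans_le (min_le_right _ _))
      linarith
    have h1l : ‖1 - l‖ ≤ 1 + R := (norm_sub_le _ _).trans (by rw [norm_one]; linarith)
    calc ‖l • w + (1 - l) • κ‖ ≤ ‖l‖ * ‖w‖ + ‖1 - l‖ * ‖κ‖ := by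
          rw [← norm_smul, ← norm_smul]
          exact norm_add_le _ _
      _ ≤ R * ‖w‖ + (1 + R) * ‖κ‖ := by gcongr
      _ < 1 := by linarith
  have hext : ∀ w ∈ ball (0 : SeqHilbert) 1, ∃ u : (Fin q → ℂ) → X,
      MDifferentiableOn 𝓘(ℂ, Fin q → ℂ) 𝓘(ℂ, SeqHilbert) u D ∧ ∀ z ∈ A, u z = F (z, w) := by
    intro w hw
    obtain ⟨R, hR1, η, hη, -, hball⟩ := hdisc w hw
    obtain ⟨Γ, hΓ, hΓF⟩ := hX.exists_extension_line hr0 hr1 hF (w := w) (κ := 0) (R := R)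
      (by linarith) (by simpa using hr0) (hball 0 (mem_ball_self hη))
    have h1 : (1 : ℂ) ∈ ball (0 : ℂ) R := by simpa using hR1
    refine ⟨fun z => Γ (z, 1), hslice hΓ 1 h1, fun z hz => ?_⟩
    simpa using hΓF z hz 1 h1
  have : Nonempty X := ⟨f 0⟩
  choose! u hu huF using hext
  let g : (Fin q → ℂ) × SeqHilbert → X := fun p => u p.2 p.1
  have hg : MDifferentiableOn 𝓘(ℂ, (Fin q → ℂ) × SeqHilbert) 𝓘(ℂ, SeqHilbert) g
      (D ×ˢ ball 0 1) := by
    refine mdifferentiableOn_prod_of_lines hDo hDc hAo hAD ⟨a, ha⟩ isOpen_ball ?_ ?_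
    · exact (hF.mono subset_union_right).congr fun p hp => huF p.2 hp.2 p.1 hp.1
    · intro w hw
      obtain ⟨R, hR1, η, hη, hηr, hball⟩ := hdisc w hw
      refine ⟨R, hR1, η, hη, fun κ hκ => ⟨hball κ hκ, ?_⟩⟩
      obtain ⟨Γ, hΓ, hΓF⟩ := hX.exists_extension_line hr0 hr1 hF (w := w) (κ := κ) (R := R)
        (by linarith) ((mem_ball_zero_iff.1 hκ).trans_le hηr) (hball κ hκ)
      refine hΓ.congr fun p hp => ?_
      refine huniq (u (p.2 • w + (1 - p.2) • κ)) (fun z => Γ (z, p.2)) (hu _ (hball κ hκ _ hp.2))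
        (hslice hΓ p.2 hp.2) (fun z hz => ?_) hp.1
      exact (huF _ (hball κ hκ _ hp.2) z hz).trans (hΓF z hz _ hp.2).symm
  refine ⟨g ∘ seqSplit q, hg.comp (seqSplit q).differentiable.mdifferentiable.mdifferentiableOn
    (seqProd_eq_preimage D (ball 0 1)).le, ?_⟩
  rintro x (⟨h1, h2⟩ | ⟨h1, h2⟩)
  · have hw : seqTail q x ∈ ball (0 : SeqHilbert) 1 := ball_subset_ball hr1.le h2
    rw [← hFf x]
    refine huniq (u (seqTail q x)) (fun z => F (z, seqTail q x)) (hu _ hw) ?_ (huF _ hw) h1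
    have h3 : MDifferentiableOn 𝓘(ℂ, Fin q → ℂ) 𝓘(ℂ, (Fin q → ℂ) × SeqHilbert)
        (fun z : Fin q → ℂ => (z, seqTail q x)) D :=
      mdifferentiableOn_iff_differentiableOn.2 (by fun_prop)
    exact hF.comp h3 fun z hz => Or.inl ⟨hz, h2⟩
  · rw [← hFf x]
    exact huF _ h2 _ h1
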